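/- Let $\mathbb{F}_q$ be a finite field with $q$ elements and let $A$ be a finite-dimensional associative (not necessarily unital) algebra over $\mathbb{F}_q$ that is nilpotent, i.e. for some $m\ge 1$ every product $a_1a_2\cdots a_m$ of $m$ elements of $A$ is zero. Let $1+A$ be the finite group of all formal expressions $1+x$ with $x\in A$, under the operation $(1+x)(1+y)=1+(x+y+xy)$. Then every complex irreducible representation of $1+A$ is finite-dimensional, and its dimension is $q^k$ for some integer $k\ge 0$. In particular, for every $n \ge 0$, every complex irreducible representation of the group $UL_n(\mathbb{F}_q)$ of upper-triangular $n\times n$ matrices over $\mathbb{F}_q$ with all diagonal entries equal to $1$ is finite-dimensional, of dimension $q^k$ for some integer $k\ge 0$. -/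

import Mathlib

/-- `algPow F A m` is the subspace `A ^ m` (`1 ≤ m`) of the not necessarily unital associative
algebra `A`: the span of all products `a₁ a₂ ⋯ aₘ` of `m` elements of `A`, such a product being
written as `a` multiplied on the right by the successive members of a list of length `m - 1`. -/
def algPow (F A : Type*) [Field F] [NonUnitalRing A] [Module F A] (m : ℕ) : Submodule F A :=
  Submodule.span F {x | ∃ (a : A) (l : List A), l.length + 1 = m ∧ x = l.foldl (· * ·) a}

/-- An associative algebra `A` is nilpotent if `A ^ m = 0` for some `m ≥ 1`. -/
class IsNilpotentAlgebra (F A : Type*) [Field F] [NonUnitalRing A] [Module F A] : Prop where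
  exists_pow_eq_bot : ∃ m : ℕ, 1 ≤ m ∧ algPow F A m = ⊥

/-- The set `1 + A` of all formal expressions `1 + x` with `x ∈ A`; the term `⟨x⟩` stands for
`1 + x`. -/
@[ext]
structure OnePlus (F A : Type*) where
  val : A

namespace OnePlus

variable {F A : Type*} [Field F] [NonUnitalRing A] [Module F A]
  [IsScalarTower F A A] [SMulCommClass F A A]

theorem inr_foldl (l : List A) (a : A) :
    (Unitization.inr (l.foldl (· * ·) a) : Unitization F A) =
      Unitization.inr a * (l.map (Unitization.inr : A → Unitization F A)).prod := by
  induction l generalizing a with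
  | nil => simp
  | cons b l ih => simp [ih, mul_assoc]

theorem isUnit_one_add_inr [IsNilpotentAlgebra F A] (x : A) :
    IsUnit (1 + (Unitization.inr x : Unitization F A)) := by
  obtain ⟨m, hm, h⟩ := IsNilpotentAlgebra.exists_pow_eq_bot (F := F) (A := A)
  refine IsNilpotent.isUnit_one_add ⟨m, ?_⟩
  obtain ⟨k, rfl⟩ := Nat.exists_eq_add_of_le' hm
  have hx : (List.replicate k x).foldl (· * ·) x = 0 := by
    rw [← Submodule.mem_bot F, ← h]
    exact Submodule.subset_span ⟨x, List.replicate k x, by simp, rfl⟩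
  have h2 := inr_foldl (F := F) (List.replicate k x) x
  rw [hx] at h2
  simpa [pow_succ'] using h2.symm

/-- `(1 + x) (1 + y) = 1 + (x + y + x y)`. -/
instance : Mul (OnePlus F A) := ⟨fun a b => ⟨a.val + b.val + a.val * b.val⟩⟩

instance : One (OnePlus F A) := ⟨⟨0⟩⟩

/-- The inverse of `1 + x`, computed in the unital algebra `F ⊕ A` obtained from `A` by adjoining
a unit. -/
noncomputable instance : Inv (OnePlus F A) :=
  ⟨fun a => ⟨(Ring.inverse (1 + (Unitization.inr a.val : Unitization F A))).snd⟩⟩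

/-- For a nilpotent algebra `A`, the set `1 + A` is a group. -/
noncomputable instance [IsNilpotentAlgebra F A] : Group (OnePlus F A) :=
  Group.ofLeftAxioms
    (fun a b c => by
      apply OnePlus.ext
      change (a.val + b.val + a.val * b.val) + c.val + (a.val + b.val + a.val * b.val) * c.val =
        a.val + (b.val + c.val + b.val * c.val) + a.val * (b.val + c.val + b.val * c.val)
      simp only [add_mul, mul_add, mul_assoc]
      abel)
    (fun a => by
      apply OnePlus.ext
      change 0 + a.val + 0 * a.val = a.val
      simp)
    (fun a => by
      apply OnePlus.ext
      have h := Ring.inverse_mul_cancel _ (isUnit_one_add_inr (F := F) a.val)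
      have h1 := congrArg (fun z => z.fst) h
      have h2 := congrArg (fun z => z.snd) h
      simp only [Unitization.fst_mul, Unitization.fst_add, Unitization.fst_one,
        Unitization.fst_inr, add_zero, mul_one] at h1
      simp only [Unitization.snd_mul, Unitization.snd_add, Unitization.snd_one,
        Unitization.fst_add, Unitization.fst_one, Unitization.fst_inr, h1,
        Unitization.snd_inr, zero_add, add_zero, one_smul] at h2
      change (Ring.inverse (1 + (Unitization.inr a.val : Unitization F A))).snd + a.val +
        (Ring.inverse (1 + (Unitization.inr a.val : Unitization F A))).snd * a.val = 0
      rw [← h2]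
      abel)

end OnePlus

/-- The group `UL n F` of unipotent upper-triangular `n × n` matrices over `F`: the matrices with
ones on the diagonal and zeros below it, as a subgroup of the general linear group. -/
def UL (n : ℕ) (F : Type*) [Field F] : Subgroup (Matrix.GeneralLinearGroup (Fin n) F) where
  carrier := {g | (∀ i, g.val i i = 1) ∧ ∀ i j, j < i → g.val i j = 0}
  one_mem' := ⟨fun i => by simp, fun i j h => by simp [h.ne']⟩
  mul_mem' := by
    rintro g h ⟨hg, hg'⟩ ⟨hh, hh'⟩
    refine ⟨fun i => ?_, fun i j hij => ?_⟩
    · rw [Units.val_mul, Matrix.mul_apply, Finset.sum_eq_single i]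
      · rw [hg, hh, one_mul]
      · intro k _ hk
        rcases lt_or_gt_of_ne hk with hk | hk
        · rw [hg' i k hk, zero_mul]
        · rw [hh' k i hk, mul_zero]
      · simp
    · rw [Units.val_mul, Matrix.mul_apply]
      refine Finset.sum_eq_zero fun k _ => ?_
      rcases lt_or_ge k i with hk | hk
      · rw [hg' i k hk, zero_mul]
      · rw [hh' k j (hij.trans_le hk), mul_zero]
  inv_mem' := by
    rintro g ⟨hg, hg'⟩
    have hT : Matrix.BlockTriangular g.val id := fun i j h => hg' i j h
    have : Invertible g.val := g.invertible
    have hI : Matrix.BlockTriangular (g⁻¹).val id := by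
      rw [Matrix.coe_units_inv]
      exact Matrix.blockTriangular_inv_of_blockTriangular hT
    refine ⟨fun i => ?_, fun i j hij => hI hij⟩
    have h1 : ((g⁻¹).val * g.val) i i = 1 := by
      rw [← Units.val_mul, inv_mul_cancel]; simp
    rw [Matrix.mul_apply, Finset.sum_eq_single i] at h1
    · rwa [hg, mul_one] at h1
    · intro k _ hk
      rcases lt_or_gt_of_ne hk with hk | hk
      · rw [hI (show id k < id i from hk), zero_mul]
      · rw [hg' k i hk, mul_zero]
    · simp

/-! Induct on `dim A`. If `1 + A` acts by scalars, irreducibility makes `V` a line. Otherwise let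
`M` be the last power of `A` such that `1 + M` does not act by scalars, and `K` the next one: `K`
contains `M A` and `A M`, and `1 + K` acts by scalars. Choose `y ∈ M` with `π (1 - y)` not scalar.

The operators of `1 - y` and `1 + b` commute up to the scalar `pairing l y b`. As a function of `b`
this scalar is additive and trivial on `A²` (`pairing_add`, `pairing_mul`). Hence `b ↦ (c ↦ pairing
l y (c • b))` is linear from `A` to the dual of `F`, and gives a homomorphism from `1 + A` to that
dual whose kernel is `1 + B` for a subalgebra `B`. By Schur it is nontrivial, hence onto, and `B ≠
A`.

The operators of the elements `1 - c y` commute, and `1 + A` permutes their joint generalised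
eigenspaces through this homomorphism. So `V` is a direct sum of `q` translates of one such
eigenspace, on which `1 + B` acts irreducibly (`exists_subalgebra_representation`). Induction
applies to `B`. The matrix case takes `A` strictly upper triangular. -/

namespace Representation

/-! ### Irreducibility in terms of invariant subspaces, and Schur's lemma. -/

section General

variable {k G V : Type*} [Field k] [Group G] [AddCommGroup V] [Module k V]
  {π : Representation k G V}

theorem IsIrreducible.submodule_eq_bot_or_eq_top (h : π.IsIrreducible) (W : Submodule k V)
    (hW : ∀ g, ∀ v ∈ W, π g v ∈ W) : W = ⊥ ∨ W = ⊤ := by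
  have := h
  rcases IsSimpleOrder.eq_bot_or_eq_top (⟨W, fun g v hv => hW g v hv⟩ : Subrepresentation π) with h | h
  · exact Or.inl (congrArg Subrepresentation.toSubmodule h)
  · exact Or.inr (congrArg Subrepresentation.toSubmodule h)

theorem IsIrreducible.nontrivial (h : π.IsIrreducible) : Nontrivial V := by
  by_contra hV
  rw [not_nontrivial_iff_subsingleton] at hV
  have := h.toNontrivial
  refine bot_ne_top (α := Subrepresentation π) (Subrepresentation.toSubmodule_injective ?_)
  exact Subsingleton.elim _ _

theorem isIrreducible_of_forall [Nontrivial V]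
    (h : ∀ W : Submodule k V, (∀ g, ∀ v ∈ W, π g v ∈ W) → W = ⊥ ∨ W = ⊤) :
    π.IsIrreducible where
  exists_pair_ne :=
    ⟨⊥, ⊤, fun e => bot_ne_top (α := Submodule k V)
      (congrArg Subrepresentation.toSubmodule e)⟩
  eq_bot_or_eq_top W := by
    rcases h W.toSubmodule fun g v hv => W.apply_mem_toSubmodule g hv with h | h
    · exact Or.inl (Subrepresentation.toSubmodule_injective h)
    · exact Or.inr (Subrepresentation.toSubmodule_injective h)

theorem IsIrreducible.comp_surjective {H : Type*} [Group H] (h : π.IsIrreducible)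
    (f : H →* G) (hf : Function.Surjective f) :
    IsIrreducible (π.comp f : Representation k H V) := by
  have := h.nontrivial
  refine isIrreducible_of_forall fun W hW => h.submodule_eq_bot_or_eq_top W fun g v hv => ?_
  obtain ⟨x, rfl⟩ := hf g
  exact hW x v hv

/-- The finite orbit of a nonzero vector spans an invariant subspace. -/
theorem IsIrreducible.finiteDimensional [Finite G] (h : π.IsIrreducible) :
    FiniteDimensional k V := by
  have := h.nontrivial
  obtain ⟨v, hv⟩ := exists_ne (0 : V)
  have hmem : v ∈ Submodule.span k (Set.range fun g => π g v) :=
    Submodule.subset_span ⟨1, by simp⟩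
  rcases h.submodule_eq_bot_or_eq_top (Submodule.span k (Set.range fun g => π g v)) (fun g w hw => by
    induction hw using Submodule.span_induction with
    | mem x hx =>
      obtain ⟨a, rfl⟩ := hx
      exact Submodule.subset_span ⟨g * a, by simp⟩
    | zero => simp
    | add x y _ _ hx hy => rw [map_add]; exact add_mem hx hy
    | smul c x _ hx => rw [map_smul]; exact Submodule.smul_mem _ c hx) with h | h
  · rw [h, Submodule.mem_bot] at hmem
    exact absurd hmem hv
  · exact Module.finite_def.2 (h ▸ Submodule.fg_span (Set.finite_range _))

theorem IsIrreducible.exists_eq_smul_one [IsAlgClosed k] [FiniteDimensional k V]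
    (h : π.IsIrreducible) (T : Module.End k V) (hT : ∀ g, Commute T (π g)) :
    ∃ c : k, T = c • 1 := by
  have := h.nontrivial
  obtain ⟨c, hc⟩ := Module.End.exists_eigenvalue T
  refine ⟨c, ?_⟩
  rcases h.submodule_eq_bot_or_eq_top (T.eigenspace c) fun g v hv => by
    rw [Module.End.mem_eigenspace_iff] at hv ⊢
    rw [← Module.End.mul_apply, (hT g).eq, Module.End.mul_apply, hv, map_smul] with h | h
  · exact absurd h hc
  · ext v
    exact Module.End.mem_eigenspace_iff.1 (h ▸ Submodule.mem_top : v ∈ T.eigenspace c)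

theorem IsIrreducible.finrank_eq_one_of_forall_smul (h : π.IsIrreducible)
    (hs : ∀ g, ∃ c : k, π g = c • 1) : Module.finrank k V = 1 := by
  have := h.nontrivial
  obtain ⟨v, hv⟩ := exists_ne (0 : V)
  refine (finrank_eq_one_iff_of_nonzero v hv).2 ?_
  rcases h.submodule_eq_bot_or_eq_top (Submodule.span k {v}) fun g w hw => by
    obtain ⟨c, hc⟩ := hs g
    rw [hc]
    exact Submodule.smul_mem _ c hw with h | h
  · exact absurd (Submodule.span_singleton_eq_bot.1 h) hv
  · exact h

end General

/-! ### Systems of imprimitivity permuted through a surjection onto `X`. -/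

section Imprimitivity

variable {k G V X : Type*} [Field k] [Group G] [AddCommGroup V] [Module k V]
  {π : Representation k G V} [Group X] {χ : G →* X} {U : X → Submodule k V}

/-- Stability under `ker χ` makes a translate of `W` depend only on its coset, so the sum over coset
representatives is invariant. -/
theorem iSup_eq_top_of_translate (h : π.IsIrreducible)
    (hχ : Function.Surjective χ) {W : Submodule k V} (hW : W ≠ ⊥)
    (hker : ∀ g, χ g = 1 → ∀ v ∈ W, π g v ∈ W) :
    ⨆ x : X, W.map (π (Function.surjInv hχ x)) = ⊤ := by
  have hs := Function.surjInv_eq hχ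
  have key : ∀ g, ∀ v ∈ W, π g v ∈ ⨆ x : X, W.map (π (Function.surjInv hχ x)) := by
    intro g v hv
    refine Submodule.mem_iSup_of_mem (χ g) ⟨π ((Function.surjInv hχ (χ g))⁻¹ * g) v,
      hker _ (by simp [hs]) v hv, ?_⟩
    rw [← Module.End.mul_apply, ← map_mul, mul_inv_cancel_left]
  refine (h.submodule_eq_bot_or_eq_top _ fun g v hv => ?_).resolve_left fun hbot => hW ?_
  · suffices ⨆ x : X, W.map (π (Function.surjInv hχ x)) ≤
        (⨆ x : X, W.map (π (Function.surjInv hχ x))).comap (π g) from this hv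
    refine iSup_le fun x => ?_
    rintro _ ⟨w, hw, rfl⟩
    rw [Submodule.mem_comap, ← Module.End.mul_apply, ← map_mul]
    exact key _ w hw
  · rw [eq_bot_iff, ← hbot]
    intro v hv
    simpa using key 1 v hv

/-- This yields irreducibility of `U 1` under `ker χ`: the translates of `W` span `V`, those with `x
≠ 1` lie in the other blocks, and the modular law leaves no room in `U 1` outside `W`. -/
theorem eq_of_imprimitive (h : π.IsIrreducible) (hχ : Function.Surjective χ)
    (hU : iSupIndep U) (hmap : ∀ g x, ∀ v ∈ U x, π g v ∈ U (χ g * x))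
    {W : Submodule k V} (hWU : W ≤ U 1) (hW : W ≠ ⊥)
    (hker : ∀ g, χ g = 1 → ∀ v ∈ W, π g v ∈ W) : W = U 1 := by
  have htop := iSup_eq_top_of_translate h hχ hW hker
  have hs := Function.surjInv_eq hχ
  have hle : ∀ x, W.map (π (Function.surjInv hχ x)) ≤ U x := by
    rintro x _ ⟨w, hw, rfl⟩
    simpa [hs] using hmap (Function.surjInv hχ x) 1 w (hWU hw)
  have hsup : (⊤ : Submodule k V) ≤ W ⊔ ⨆ (x) (_ : x ≠ 1), U x := by
    rw [← htop]
    refine iSup_le fun x => ?_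
    by_cases hx : x = 1
    · subst hx
      refine le_sup_of_le_left ?_
      rintro _ ⟨w, hw, rfl⟩
      exact hker _ (hs 1) w hw
    · exact le_sup_of_le_right ((hle x).trans (le_iSup₂_of_le x hx le_rfl))
  have hd : Disjoint (U 1) (⨆ (x) (_ : x ≠ 1), U x) := hU 1
  refine le_antisymm hWU ?_
  calc U 1 ≤ (W ⊔ ⨆ (x) (_ : x ≠ 1), U x) ⊓ U 1 := le_inf (le_top.trans hsup) le_rfl
    _ = W ⊔ (⨆ (x) (_ : x ≠ 1), U x) ⊓ U 1 := sup_inf_assoc_of_le _ hWU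
    _ = W := by rw [hd.symm.eq_bot, sup_bot_eq]

theorem finrank_eq_of_imprimitive [FiniteDimensional k V] [Finite X] (h : π.IsIrreducible)
    (hχ : Function.Surjective χ)
    (hU : iSupIndep U) (hmap : ∀ g x, ∀ v ∈ U x, π g v ∈ U (χ g * x)) (h1 : U 1 ≠ ⊥) :
    Module.finrank k V = Nat.card X * Module.finrank k (U 1) := by
  classical
  have := Fintype.ofFinite X
  have hs := Function.surjInv_eq hχ
  have htop : ⨆ x, U x = ⊤ := by
    rw [eq_top_iff, ← iSup_eq_top_of_translate h hχ h1 fun g hg v hv => by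
      simpa [hg] using hmap g 1 v hv]
    refine iSup_mono fun x => ?_
    rintro _ ⟨w, hw, rfl⟩
    simpa [hs] using hmap (Function.surjInv hχ x) 1 w hw
  have hint : DirectSum.IsInternal U :=
    DirectSum.isInternal_submodule_iff_iSupIndep_and_iSup_eq_top U |>.2 ⟨hU, htop⟩
  have hfin : ∀ g x y, χ g * x = y → Module.finrank k (U x) ≤ Module.finrank k (U y) := by
    rintro g x y rfl
    exact LinearMap.finrank_le_finrank_of_injective (f := (π g).restrict (hmap g x))
      fun a b hab => Subtype.ext <| by
        have := congrArg (π g⁻¹) (congrArg Subtype.val hab)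
        simpa [← Module.End.mul_apply, ← map_mul] using this
  have heq : ∀ x, Module.finrank k (U x) = Module.finrank k (U 1) := fun x =>
    le_antisymm (hfin (Function.surjInv hχ x⁻¹) _ _ (by simp [hs]))
      (hfin (Function.surjInv hχ x) _ _ (by simp [hs]))
  rw [(LinearEquiv.ofBijective (DirectSum.coeLinearMap U) hint).finrank_eq.symm,
    Module.finrank_directSum]
  simp [heq, Nat.card_eq_fintype_card]

end Imprimitivity

end Representation

/-! ### Powers of a nilpotent algebra. -/

section AlgPow

variable {F A : Type*} [Field F] [NonUnitalRing A] [Module F A]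

theorem algPow_one : algPow F A 1 = ⊤ :=
  eq_top_iff.2 fun a _ => Submodule.subset_span ⟨a, [], rfl, rfl⟩

theorem mul_mem_algPow_succ [IsScalarTower F A A] {m : ℕ} {y : A} (hy : y ∈ algPow F A m)
    (a : A) : y * a ∈ algPow F A (m + 1) := by
  induction hy using Submodule.span_induction with
  | mem x hx =>
    obtain ⟨b, l, hl, rfl⟩ := hx
    exact Submodule.subset_span ⟨b, l ++ [a], by simpa using hl, by simp⟩
  | zero => simp
  | add x y _ _ hx hy => rw [add_mul]; exact add_mem hx hy
  | smul c x _ hx => rw [smul_mul_assoc]; exact Submodule.smul_mem _ c hx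

theorem mul_foldl_mul (a b : A) (l : List A) :
    a * l.foldl (· * ·) b = l.foldl (· * ·) (a * b) := by
  induction l generalizing b with
  | nil => rfl
  | cons c l ih => simp [ih, mul_assoc]

theorem mul_mem_algPow_succ' [SMulCommClass F A A] {m : ℕ} {y : A} (hy : y ∈ algPow F A m)
    (a : A) : a * y ∈ algPow F A (m + 1) := by
  induction hy using Submodule.span_induction with
  | mem x hx =>
    obtain ⟨b, l, hl, rfl⟩ := hx
    exact Submodule.subset_span ⟨a, b :: l, by simpa using hl, by simp [mul_foldl_mul]⟩
  | zero => simp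
  | add x y _ _ hx hy => rw [mul_add]; exact add_mem hx hy
  | smul c x _ hx => rw [mul_smul_comm]; exact Submodule.smul_mem _ c hx

theorem algPow_succ_succ_le (m : ℕ) : algPow F A (m + 1 + 1) ≤ algPow F A (m + 1) := by
  refine Submodule.span_mono ?_
  rintro _ ⟨a, _ | ⟨b, l⟩, hl, rfl⟩
  · simp at hl
  · exact ⟨a * b, l, by simpa using hl, rfl⟩

instance NonUnitalSubalgebra.isNilpotentAlgebra [IsNilpotentAlgebra F A]
    (B : NonUnitalSubalgebra F A) : IsNilpotentAlgebra F B := by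
  obtain ⟨m, hm, h⟩ := IsNilpotentAlgebra.exists_pow_eq_bot (F := F) (A := A)
  refine ⟨m, hm, ?_⟩
  rw [eq_bot_iff, algPow, Submodule.span_le]
  rintro _ ⟨a, l, hl, rfl⟩
  have hcoe : ∀ (l : List B) (a : B), ((l.foldl (· * ·) a : B) : A) =
      (l.map ((↑) : B → A)).foldl (· * ·) (a : A) := by
    intro l
    induction l with
    | nil => intro a; rfl
    | cons b l ih => intro a; simp [ih]
  have : ((l.foldl (· * ·) a : B) : A) ∈ algPow F A m :=
    Submodule.subset_span ⟨a, l.map (↑), by simpa using hl, hcoe l a⟩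
  rw [h, Submodule.mem_bot] at this
  exact Subtype.ext this

end AlgPow

/-! ### The group `1 + A` and the commutation identity. -/

namespace OnePlus

section Mul

variable {F A : Type*} [NonUnitalRing A]

theorem val_mul (x y : OnePlus F A) : (x * y).val = x.val + y.val + x.val * y.val := rfl

theorem val_one : (1 : OnePlus F A).val = 0 := rfl

end Mul

section Group

variable {F A : Type*} [Field F] [NonUnitalRing A] [Module F A]
  [IsScalarTower F A A] [SMulCommClass F A A]

instance [Finite A] : Finite (OnePlus F A) :=
  Finite.of_injective OnePlus.val fun _ _ => OnePlus.ext

variable [IsNilpotentAlgebra F A]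

theorem val_add_val_inv (x : OnePlus F A) : x.val + x⁻¹.val + x.val * x⁻¹.val = 0 := by
  rw [← val_mul, mul_inv_cancel, val_one]

theorem val_inv_add_val (x : OnePlus F A) : x⁻¹.val + x.val + x⁻¹.val * x.val = 0 := by
  rw [← val_mul, inv_mul_cancel, val_one]

/-- With `y' = (1 - y)⁻¹ - 1`, both sides equal `(1 + b) (1 + y' (1 + b))`. -/
theorem mk_mul_inv_mul_mk (y b : A) :
    (⟨b⟩ : OnePlus F A) * (⟨-y⟩ : OnePlus F A)⁻¹ * ⟨y * b⟩ =
      ⟨b * y⟩ * (⟨-y⟩ : OnePlus F A)⁻¹ * ⟨b⟩ := by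
  have h1 := val_add_val_inv (⟨-y⟩ : OnePlus F A)
  have h2 := val_inv_add_val (⟨-y⟩ : OnePlus F A)
  set u := (⟨-y⟩ : OnePlus F A)⁻¹ with hu
  have h3 : u.val = y + y * u.val := by
    rw [← sub_eq_zero, ← h1]
    simp only [neg_mul]
    abel
  have h4 : u.val = y + u.val * y := by
    rw [← sub_eq_zero, ← h2]
    simp only [mul_neg]
    abel
  have e1 : u * ⟨y * b⟩ = ⟨u.val + u.val * b⟩ := by
    apply OnePlus.ext
    change u.val + y * b + u.val * (y * b) = u.val + u.val * b
    conv_rhs => rw [h4]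
    nth_rewrite 1 [h4]
    rw [add_mul, mul_assoc]
    abel
  have e2 : ⟨b * y⟩ * u = ⟨u.val + b * u.val⟩ := by
    apply OnePlus.ext
    change b * y + u.val + b * y * u.val = u.val + b * u.val
    conv_rhs => enter [2]; rw [h3]
    rw [mul_add, mul_assoc]
    abel
  rw [mul_assoc, e1, e2]
  apply OnePlus.ext
  change b + (u.val + u.val * b) + b * (u.val + u.val * b) =
    (u.val + b * u.val) + b + (u.val + b * u.val) * b
  rw [mul_add, add_mul, mul_assoc]
  abel

/-- The inclusion of `1 + B` into `1 + A` for a subalgebra `B` of `A`. -/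
def ofSubalgebra (B : NonUnitalSubalgebra F A) : OnePlus F B →* OnePlus F A where
  toFun x := ⟨x.val⟩
  map_one' := rfl
  map_mul' _ _ := rfl

end Group

end OnePlus

/-! ### The pairing and its characters. -/

/-- The scalar by which the commutator of `1 - y` and `1 + b` acts, when `1 + z` acts by the
scalar `l z` for `z` in an ideal containing `y b` and `b y`. -/
noncomputable def pairing {A : Type*} [Mul A] (l : A → ℂ) (y b : A) : ℂ := l (b * y) / l (y * b)

/-- Scalars move across the pairing, so one character governs the commutation of `1 + b` with every
`1 - c y`. -/
theorem pairing_smul {F A : Type*} [Field F] [NonUnitalRing A] [Module F A]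
    [IsScalarTower F A A] [SMulCommClass F A A] {l : A → ℂ} (c : F) (y b : A) :
    pairing l (c • y) b = pairing l y (c • b) := by
  simp [pairing, mul_smul_comm, smul_mul_assoc]

/-- The data of a representation of `1 + A`, ideals `K ≤ M` with `M A + A M ≤ K`, and a function
`l` giving the scalars by which `1 + K` acts. -/
structure ActsByScalars {F A V : Type*} [Field F] [NonUnitalRing A] [Module F A]
    [IsScalarTower F A A] [SMulCommClass F A A] [IsNilpotentAlgebra F A] [AddCommGroup V]
    [Module ℂ V] (π : Representation ℂ (OnePlus F A) V) (M K : Submodule F A) (l : A → ℂ) :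
    Prop where
  le : K ≤ M
  mul_mem : ∀ y ∈ M, ∀ a, y * a ∈ K
  mul_mem' : ∀ y ∈ M, ∀ a, a * y ∈ K
  apply_eq : ∀ z ∈ K, π ⟨z⟩ = l z • 1

namespace ActsByScalars

variable {F A V : Type*} [Field F] [NonUnitalRing A] [Module F A]
    [IsScalarTower F A A] [SMulCommClass F A A] [IsNilpotentAlgebra F A] [AddCommGroup V]
    [Module ℂ V] [Nontrivial V] {π : Representation ℂ (OnePlus F A) V} {M K : Submodule F A}
    {l : A → ℂ}

theorem ne_zero (h : ActsByScalars π M K l) {z : A} (hz : z ∈ K) : l z ≠ 0 := by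
  intro h0
  have h1 : π ⟨z⟩ * π (⟨z⟩ : OnePlus F A)⁻¹ = 1 := by rw [← map_mul, mul_inv_cancel, map_one]
  rw [h.apply_eq z hz, h0, zero_smul, zero_mul] at h1
  exact zero_ne_one h1

theorem smul_mul_injective (g g' : OnePlus F A) {c d : ℂ}
    (hcd : c • (π g * π g') = d • (π g * π g')) : c = d := by
  obtain ⟨v, hv⟩ := exists_ne (0 : V)
  rw [← map_mul] at hcd
  have := congrArg (fun T => T (π (g * g')⁻¹ v)) hcd
  simp only [LinearMap.smul_apply, ← Module.End.mul_apply, ← map_mul, mul_inv_cancel, map_one,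
    Module.End.one_apply] at this
  exact smul_left_injective ℂ hv this

/-- Apply `π` to `mk_mul_inv_mul_mk`, where `1 + y b` and `1 + b y` become scalars, then multiply by
`π (1 - y)` on both sides. -/
theorem apply_mul_apply (h : ActsByScalars π M K l) {y : A} (hy : y ∈ M) (b : A) :
    π ⟨-y⟩ * π ⟨b⟩ = pairing l y b • (π ⟨b⟩ * π ⟨-y⟩) := by
  have e := congrArg π (OnePlus.mk_mul_inv_mul_mk (F := F) y b)
  simp only [map_mul, h.apply_eq _ (h.mul_mem y hy b), h.apply_eq _ (h.mul_mem' y hy b)] at e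
  simp only [mul_smul_comm, smul_mul_assoc, mul_one, one_mul] at e
  have hn := h.ne_zero (h.mul_mem y hy b)
  have e' : π ⟨b⟩ * π (⟨-y⟩ : OnePlus F A)⁻¹ =
      pairing l y b • (π (⟨-y⟩ : OnePlus F A)⁻¹ * π ⟨b⟩) := by
    rw [pairing, div_eq_inv_mul, mul_smul, ← e, smul_smul, inv_mul_cancel₀ hn, one_smul]
  have h₁ : π ⟨-y⟩ * π (⟨-y⟩ : OnePlus F A)⁻¹ = 1 := by rw [← map_mul, mul_inv_cancel, map_one]
  have h₂ : π (⟨-y⟩ : OnePlus F A)⁻¹ * π ⟨-y⟩ = 1 := by rw [← map_mul, inv_mul_cancel, map_one]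
  calc π ⟨-y⟩ * π ⟨b⟩ = π ⟨-y⟩ * (π ⟨b⟩ * π (⟨-y⟩ : OnePlus F A)⁻¹) * π ⟨-y⟩ := by
        rw [mul_assoc, mul_assoc, h₂, mul_one]
    _ = pairing l y b • (π ⟨-y⟩ * π (⟨-y⟩ : OnePlus F A)⁻¹ * π ⟨b⟩ * π ⟨-y⟩) := by
        rw [e', mul_smul_comm, smul_mul_assoc, mul_assoc, mul_assoc, mul_assoc, mul_assoc]
    _ = _ := by rw [h₁, one_mul]

theorem pairing_circle (h : ActsByScalars π M K l) {y : A} (hy : y ∈ M) (b c : A) :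
    pairing l y (b + c + b * c) = pairing l y b * pairing l y c := by
  refine smul_mul_injective (π := π) ⟨b + c + b * c⟩ ⟨-y⟩ ?_
  rw [← h.apply_mul_apply hy]
  have e : π ⟨b + c + b * c⟩ = π ⟨b⟩ * π ⟨c⟩ := by rw [← map_mul]; rfl
  rw [e, ← mul_assoc, h.apply_mul_apply hy, smul_mul_assoc, mul_assoc, h.apply_mul_apply hy,
    mul_smul_comm, smul_smul, mul_assoc]

theorem pairing_eq_one_of_mem (h : ActsByScalars π M K l) {y : A} (hy : y ∈ K) (b : A) :
    pairing l y b = 1 := by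
  refine smul_mul_injective (π := π) ⟨b⟩ ⟨-y⟩ ?_
  rw [← h.apply_mul_apply (h.le hy), h.apply_eq _ (neg_mem hy)]
  simp

/-- Both `y b` and `c y` lie in `K`, so they pair trivially with everything: `l (c y b) = l (y b c)`
and `l (b c y) = l (c y b)`. -/
theorem pairing_mul (h : ActsByScalars π M K l) {y : A} (hy : y ∈ M) (b c : A) :
    pairing l y (b * c) = 1 := by
  have h1 := h.pairing_eq_one_of_mem (h.mul_mem y hy b) c
  have h2 := h.pairing_eq_one_of_mem (h.mul_mem' y hy c) b
  have hn := h.ne_zero (h.mul_mem y hy (b * c))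
  rw [pairing, mul_assoc] at h1 h2
  rw [pairing, mul_assoc, ← (div_eq_one_iff_eq hn).1 h1]
  exact h2

theorem pairing_add (h : ActsByScalars π M K l) {y : A} (hy : y ∈ M) (b c : A) :
    pairing l y (b + c) = pairing l y b * pairing l y c := by
  set s : OnePlus F A := ⟨b + c + b * c⟩ with hs
  have h0 := OnePlus.val_add_val_inv s
  -- With `1 + s = (1 + b) (1 + c)`, one has `1 + b + c = (1 + s) (1 - (1 + s)⁻¹ b c)`; the last
  -- factor is `1` plus a product, hence pairs trivially.
  have e : b + c = s.val + (-(b + s⁻¹.val * b)) * c + s.val * ((-(b + s⁻¹.val * b)) * c) := by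
    have : s.val + (-(b + s⁻¹.val * b)) * c + s.val * ((-(b + s⁻¹.val * b)) * c) =
      s.val - b * c - (s.val + s⁻¹.val + s.val * s⁻¹.val) * b * c := by
      simp only [neg_mul, add_mul, mul_add, mul_neg, mul_assoc]
      abel
    rw [this, h0, hs]
    simp
  rw [e, h.pairing_circle hy, h.pairing_mul hy, mul_one, hs, h.pairing_circle hy]

theorem pairing_zero (h : ActsByScalars π M K l) {y : A} (hy : y ∈ M) : pairing l y 0 = 1 := by
  simpa using h.pairing_mul hy 0 0

/-- The character `c ↦ pairing l y (c • b)` of `F`. -/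
noncomputable def char (h : ActsByScalars π M K l) {y : A} (hy : y ∈ M) (b : A) :
    AddChar F ℂ where
  toFun c := pairing l y (c • b)
  map_zero_eq_one' := by rw [zero_smul, h.pairing_zero hy]
  map_add_eq_mul' c d := by rw [add_smul, h.pairing_add hy]

theorem char_apply (h : ActsByScalars π M K l) {y : A} (hy : y ∈ M) (b : A) (c : F) :
    h.char hy b c = pairing l y (c • b) := rfl

theorem char_add (h : ActsByScalars π M K l) {y : A} (hy : y ∈ M) (b c : A) :
    h.char hy (b + c) = h.char hy b * h.char hy c := by
  ext t
  simp [char_apply, h.pairing_add hy]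

theorem char_mul (h : ActsByScalars π M K l) {y : A} (hy : y ∈ M) (b c : A) :
    h.char hy (b * c) = 1 := by
  ext t
  rw [char_apply, ← smul_mul_assoc, h.pairing_mul hy, AddChar.one_apply]

theorem char_smul (h : ActsByScalars π M K l) {y : A} (hy : y ∈ M) (b : A) (c : F) :
    h.char hy (c • b) = (h.char hy b).mulShift c := by
  ext t
  simp [char_apply, smul_smul, mul_comm c t]

/-- `char` as a homomorphism defined on `1 + A`. -/
noncomputable def charHom (h : ActsByScalars π M K l) {y : A} (hy : y ∈ M) :
    OnePlus F A →* AddChar F ℂ where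
  toFun g := h.char hy g.val
  map_one' := by
    rw [OnePlus.val_one, ← mul_zero (0 : A), h.char_mul hy]
  map_mul' g g' := by
    rw [OnePlus.val_mul, h.char_add hy, h.char_add hy, h.char_mul hy, mul_one]

/-- A nontrivial additive character of a finite field is primitive: its shifts are distinct, and by
counting they exhaust the dual. -/
theorem charHom_surjective [Finite F] (h : ActsByScalars π M K l) {y : A} (hy : y ∈ M) {b : A}
    (hb : h.char hy b ≠ 1) : Function.Surjective (h.charHom hy) := by
  have := Fintype.ofFinite F
  have hinj : Function.Injective (h.char hy b).mulShift :=
    AddChar.to_mulShift_inj_of_isPrimitive (AddChar.IsPrimitive.of_ne_one hb)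
  have hbij := (Fintype.bijective_iff_injective_and_card _).2 ⟨hinj, AddChar.card_eq.symm⟩
  intro ψ
  obtain ⟨c, rfl⟩ := hbij.2 ψ
  exact ⟨⟨c • b⟩, h.char_smul hy b c⟩

/-- The elements of `A` with trivial character. -/
def charKer (h : ActsByScalars π M K l) {y : A} (hy : y ∈ M) : NonUnitalSubalgebra F A where
  carrier := {b | h.char hy b = 1}
  zero_mem' := (h.charHom hy).map_one
  add_mem' := by
    intro a b ha hb
    rw [Set.mem_ofPred_eq] at *
    rw [h.char_add hy, ha, hb, one_mul]
  mul_mem' _ _ := h.char_mul hy _ _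
  smul_mem' := by
    intro c b hb
    rw [Set.mem_ofPred_eq] at *
    rw [h.char_smul hy, hb]
    ext t
    simp

end ActsByScalars

/-! ### Generalised eigenspaces under commutation up to a scalar. -/

namespace Module.End

theorem mem_maxGenEigenspace_of_mul_eq {k V : Type*} [Field k] [AddCommGroup V] [Module k V]
    {P Q : Module.End k V} {t ν : k} (h : P * Q = t • (Q * P)) {v : V}
    (hv : v ∈ P.maxGenEigenspace ν) : Q v ∈ P.maxGenEigenspace (ν * t) := by
  rw [mem_maxGenEigenspace] at hv ⊢
  obtain ⟨n, hn⟩ := hv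
  -- Powers of this intertwining relation carry the vanishing of `(P - ν)ⁿ v` over to `Q v`.
  have hs : SemiconjBy Q (t • (P - ν • 1)) (P - (ν * t) • 1) := by
    rw [SemiconjBy, sub_mul, h, smul_sub, mul_sub, smul_smul, mul_smul_comm, mul_smul_comm,
      smul_mul_assoc, one_mul, mul_one, mul_comm t]
  refine ⟨n, ?_⟩
  rw [← mul_apply, ← (hs.pow_right n).eq, smul_pow, mul_apply, LinearMap.smul_apply, hn,
    smul_zero, map_zero]

theorem maxGenEigenspace_zero_eq_bot {k V : Type*} [Field k] [AddCommGroup V] [Module k V]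
    {P : Module.End k V} (h : IsUnit P) : P.maxGenEigenspace 0 = ⊥ := by
  rw [eq_bot_iff]
  intro v hv
  rw [mem_maxGenEigenspace] at hv
  obtain ⟨n, hn⟩ := hv
  rw [zero_smul, sub_zero] at hn
  obtain ⟨u, hu⟩ := h.pow n
  have := congrArg (↑u⁻¹ : Module.End k V) hn
  rwa [← hu, ← mul_apply, u.inv_mul, map_zero] at this

end Module.End

/-! ### Reduction from `A` to the subalgebra `charKer`. -/

namespace ActsByScalars

variable {F A V : Type*} [Field F] [NonUnitalRing A] [Module F A]
    [IsScalarTower F A A] [SMulCommClass F A A] [IsNilpotentAlgebra F A] [AddCommGroup V]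
    [Module ℂ V] [Nontrivial V] {π : Representation ℂ (OnePlus F A) V} {M K : Submodule F A}
    {l : A → ℂ}

theorem exists_subalgebra_representation [Finite F] [FiniteDimensional ℂ V]
    (h : ActsByScalars π M K l) (hπ : π.IsIrreducible) {y : A} (hy : y ∈ M) {b : A}
    (hb : h.char hy b ≠ 1) :
    ∃ (W : Submodule ℂ V) (σ : Representation ℂ (OnePlus F (h.charKer hy)) W),
      σ.IsIrreducible ∧ Module.finrank ℂ V = Nat.card F * Module.finrank ℂ W := by
  have hsurj := h.charHom_surjective hy hb
  -- All multiples of `y` are needed: an additive character of `F` need not be determined by its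
  -- value at one point.
  set P : F → Module.End ℂ V := fun c => π ⟨-(c • y)⟩ with hP
  have hcomm : ∀ c d, Commute (P c) (P d) := by
    intro c d
    rw [hP, Commute, SemiconjBy, ← map_mul, ← map_mul]
    refine congrArg π (OnePlus.ext ?_)
    simp only [OnePlus.val_mul, neg_mul_neg, smul_mul_smul_comm, mul_comm c d]
    rw [add_comm (-(c • y))]
  have htop := Module.End.iSup_iInf_maxGenEigenspace_eq_top_of_iSup_maxGenEigenspace_eq_top_of_commute
    P (fun c d _ => hcomm c d) fun c => Module.End.iSup_maxGenEigenspace_eq_top (P c)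
  obtain ⟨μ, hμ⟩ : ∃ μ : F → ℂ, ⨅ c, (P c).maxGenEigenspace (μ c) ≠ ⊥ := by
    by_contra! hbot
    rw [iSup_congr hbot, iSup_bot] at htop
    exact bot_ne_top htop
  -- Nonvanishing allows `μ c` to be cancelled, so distinct characters label distinct systems of
  -- eigenvalues.
  have hμ0 : ∀ c, μ c ≠ 0 := by
    intro c hc
    refine hμ (eq_bot_iff.2 ((iInf_le _ c).trans ?_))
    rw [hc, Module.End.maxGenEigenspace_zero_eq_bot ((Group.isUnit _).map π)]
  set U : AddChar F ℂ → Submodule ℂ V :=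
    fun ψ => ⨅ c, (P c).maxGenEigenspace (μ c * ψ c) with hU
  have hU1 : U 1 ≠ ⊥ := by simpa [hU] using hμ
  have hind : iSupIndep U :=
    (Module.End.independent_iInf_maxGenEigenspace_of_forall_mapsTo P fun c d φ =>
      Module.End.mapsTo_maxGenEigenspace_of_comm (hcomm d c) φ).comp
      (f := fun (ψ : AddChar F ℂ) c => μ c * ψ c) fun ψ ψ' e => by
        ext c
        exact mul_left_cancel₀ (hμ0 c) (congrFun e c)
  have hmap : ∀ g ψ, ∀ v ∈ U ψ, π g v ∈ U (h.charHom hy g * ψ) := by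
    intro g ψ v hv
    simp only [hU, Submodule.mem_iInf] at hv ⊢
    intro c
    have e : P c * π g = h.charHom hy g c • (π g * P c) := by
      have := h.apply_mul_apply (M.smul_mem c hy) g.val
      rwa [pairing_smul] at this
    have := Module.End.mem_maxGenEigenspace_of_mul_eq e (hv c)
    rwa [AddChar.mul_apply, mul_comm (h.charHom hy g c), ← mul_assoc]
  have hB : ∀ x, h.charHom hy (OnePlus.ofSubalgebra (h.charKer hy) x) = 1 := fun x => x.val.2
  have hstab : ∀ x, ∀ v ∈ U 1, π (OnePlus.ofSubalgebra (h.charKer hy) x) v ∈ U 1 := by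
    intro x v hv
    simpa [hB] using hmap (OnePlus.ofSubalgebra (h.charKer hy) x) 1 v hv
  let σ : Representation ℂ (OnePlus F (h.charKer hy)) (U 1) :=
    { toFun := fun x => (π (OnePlus.ofSubalgebra (h.charKer hy) x)).restrict (hstab x)
      map_one' := by ext; simp
      map_mul' := fun x x' => by ext; simp }
  refine ⟨U 1, σ, ?_, ?_⟩
  · have : Nontrivial (U 1) := Submodule.nontrivial_iff_ne_bot.2 hU1
    refine Representation.isIrreducible_of_forall fun W hW => ?_
    refine or_iff_not_imp_left.2 fun hW0 => ?_
    have := Representation.eq_of_imprimitive hπ hsurj hind hmap (W := W.map (U 1).subtype)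
      (Submodule.map_subtype_le _ _)
      (fun e => hW0 (Submodule.map_injective_of_injective (U 1).injective_subtype
        (e.trans (Submodule.map_bot _).symm))) ?_
    · rw [eq_top_iff]
      intro w _
      have hw : (w : V) ∈ W.map (U 1).subtype := this.ge w.2
      obtain ⟨w', hw', e⟩ := hw
      rwa [← Subtype.ext e]
    · rintro g hg _ ⟨w, hw, rfl⟩
      exact ⟨σ ⟨⟨g.val, hg⟩⟩ w, hW _ _ hw, rfl⟩
  · have := Fintype.ofFinite F
    rw [Representation.finrank_eq_of_imprimitive hπ hsurj hind hmap hU1]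
    congr 1
    rw [Nat.card_eq_fintype_card, Nat.card_eq_fintype_card, AddChar.card_eq]

end ActsByScalars

/-! ### Choice of `y` and the induction on dimension. -/

theorem exists_actsByScalars {F A V : Type*} [Field F] [NonUnitalRing A] [Module F A]
    [IsScalarTower F A A] [SMulCommClass F A A] [IsNilpotentAlgebra F A] [AddCommGroup V]
    [Module ℂ V] (π : Representation ℂ (OnePlus F A) V) (hπ : ∃ g, ∀ c : ℂ, π g ≠ c • 1) :
    ∃ (M K : Submodule F A) (l : A → ℂ) (y : A), ActsByScalars π M K l ∧ y ∈ M ∧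
      ∀ c : ℂ, π ⟨-y⟩ ≠ c • 1 := by
  classical
  have hex : ∃ m, ∀ z ∈ algPow F A (m + 1), ∃ c : ℂ, π ⟨z⟩ = c • 1 := by
    obtain ⟨m, hm, h⟩ := IsNilpotentAlgebra.exists_pow_eq_bot (F := F) (A := A)
    refine ⟨m - 1, fun z hz => ⟨1, ?_⟩⟩
    rw [Nat.sub_add_cancel hm, h, Submodule.mem_bot] at hz
    rw [hz, one_smul]
    exact map_one π
  -- The least index is positive because `algPow F A 1` is all of `A`; its predecessor then gives
  -- `M`.
  obtain ⟨m, hm⟩ : ∃ m, Nat.find hex = m + 1 := by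
    refine Nat.exists_eq_succ_of_ne_zero fun h0 => ?_
    obtain ⟨g, hg⟩ := hπ
    have := Nat.find_spec hex
    rw [h0, zero_add, algPow_one] at this
    obtain ⟨c, hc⟩ := this g.val trivial
    exact hg c hc
  have hspec := Nat.find_spec hex
  have hmin := Nat.find_min hex (m := m) (by omega)
  rw [hm] at hspec
  choose! l hl using hspec
  push Not at hmin
  obtain ⟨z, hz, hzc⟩ := hmin
  exact ⟨algPow F A (m + 1), algPow F A (m + 1 + 1), l, -z,
    ⟨algPow_succ_succ_le m, fun y hy a => mul_mem_algPow_succ hy a,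
      fun y hy a => mul_mem_algPow_succ' hy a, hl⟩, neg_mem hz, by simpa using hzc⟩

theorem OnePlus.exists_finrank_eq_pow {F : Type*} [Field F] [Finite F] (A : Type*)
    [NonUnitalRing A] [Module F A] [IsScalarTower F A A] [SMulCommClass F A A]
    [FiniteDimensional F A] [IsNilpotentAlgebra F A] (V : Type*) [AddCommGroup V] [Module ℂ V]
    (π : Representation ℂ (OnePlus F A) V) (hπ : π.IsIrreducible) :
    FiniteDimensional ℂ V ∧ ∃ k : ℕ, Module.finrank ℂ V = Nat.card F ^ k := by
  induction hn : Module.finrank F A using Nat.strong_induction_on generalizing A V with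
  | _ n ih =>
  have : Finite A := Module.finite_of_finite F
  have hfd := hπ.finiteDimensional
  have := hπ.nontrivial
  refine ⟨hfd, ?_⟩
  by_cases hsc : ∀ g, ∃ c : ℂ, π g = c • 1
  · exact ⟨0, by rw [pow_zero, hπ.finrank_eq_one_of_forall_smul hsc]⟩
  push Not at hsc
  obtain ⟨M, K, l, y, h, hy, hyc⟩ := exists_actsByScalars π hsc
  obtain ⟨b, hb⟩ : ∃ b, h.char hy b ≠ 1 := by
    by_contra! hall
    -- Were every character trivial, `π (1 - y)` would commute with the whole group and be scalar by
    -- Schur.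
    obtain ⟨c, hc⟩ := hπ.exists_eq_smul_one (π ⟨-y⟩) fun g => by
      have e1 : pairing l y g.val = 1 := by
        simpa [ActsByScalars.char_apply] using DFunLike.congr_fun (hall g.val) 1
      have := h.apply_mul_apply hy g.val
      rwa [e1, one_smul] at this
    exact hyc c hc
  obtain ⟨W, σ, hσ, hdim⟩ := h.exists_subalgebra_representation hπ hy hb
  have hlt : Module.finrank F (h.charKer hy) < n := by
    rw [← hn]
    refine Submodule.finrank_lt (s := (h.charKer hy).toSubmodule) fun e => hb ?_
    have : b ∈ (h.charKer hy).toSubmodule := e ▸ Submodule.mem_top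
    exact this
  have : FiniteDimensional F (h.charKer hy) :=
    inferInstanceAs (FiniteDimensional F (h.charKer hy).toSubmodule)
  obtain ⟨-, k, hk⟩ := ih _ hlt (h.charKer hy) W σ hσ rfl
  exact ⟨k + 1, by rw [hdim, hk, pow_succ']⟩

/-! ### Unipotent upper triangular matrices. -/

/-- The algebra of strictly upper triangular matrices. -/
def strictlyUpperTriangular (n : ℕ) (F : Type*) [Field F] :
    NonUnitalSubalgebra F (Matrix (Fin n) (Fin n) F) where
  carrier := {a | ∀ i j, j ≤ i → a i j = 0}
  zero_mem' _ _ _ := rfl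
  add_mem' ha hb i j hij := by rw [Matrix.add_apply, ha i j hij, hb i j hij, add_zero]
  mul_mem' {a b} ha hb i j hij := by
    rw [Matrix.mul_apply]
    refine Finset.sum_eq_zero fun k _ => ?_
    rcases le_or_gt k i with hk | hk
    · rw [ha i k hk, zero_mul]
    · rw [hb k j (hij.trans hk.le), mul_zero]
  smul_mem' c a ha i j hij := by rw [Matrix.smul_apply, ha i j hij, smul_zero]

namespace strictlyUpperTriangular

variable {n : ℕ} {F : Type*} [Field F]

/-- Each further strictly upper triangular factor moves the first possibly nonzero diagonal up by
one. -/
theorem foldl_apply_eq_zero (l : List (strictlyUpperTriangular n F))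
    (a : strictlyUpperTriangular n F) (d : ℕ)
    (ha : ∀ i j : Fin n, (j : ℕ) < i + d → (a : Matrix (Fin n) (Fin n) F) i j = 0)
    (i j : Fin n) (hij : (j : ℕ) < i + d + l.length) :
    ((l.foldl (· * ·) a : strictlyUpperTriangular n F) : Matrix (Fin n) (Fin n) F) i j = 0 := by
  induction l generalizing a d with
  | nil => exact ha i j hij
  | cons b l ih =>
    refine ih (a * b) (d + 1) (fun i j hij => ?_) (by rw [List.length_cons] at hij; omega)
    rw [NonUnitalSubalgebra.coe_mul, Matrix.mul_apply]
    refine Finset.sum_eq_zero fun k _ => ?_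
    rcases lt_or_ge (k : ℕ) (i + d) with hk | hk
    · rw [ha i k hk, zero_mul]
    · rw [b.2 k j (Fin.le_def.2 (by omega)), mul_zero]

instance : IsNilpotentAlgebra F (strictlyUpperTriangular n F) := by
  -- The count starts from `d = 0`, so the `n` factors after the first clear all diagonals; `n + 1`
  -- also covers `n = 0`.
  refine ⟨n + 1, by omega, ?_⟩
  rw [eq_bot_iff, algPow, Submodule.span_le]
  rintro _ ⟨a, l, hl, rfl⟩
  refine Subtype.ext (Matrix.ext fun i j => ?_)
  exact foldl_apply_eq_zero l a 0 (fun i j hij => a.2 i j (Fin.le_def.2 (by omega))) i j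
    (by omega)

/-- The homomorphism `1 + x ↦ 1 + x` to matrices. -/
def toMatrix : OnePlus F (strictlyUpperTriangular n F) →* Matrix (Fin n) (Fin n) F where
  toFun x := 1 + (x.val : Matrix (Fin n) (Fin n) F)
  map_one' := add_zero _
  map_mul' x y := by
    rw [OnePlus.val_mul]
    simp only [NonUnitalSubalgebra.coe_add, NonUnitalSubalgebra.coe_mul]
    noncomm_ring

/-- The homomorphism `1 + x ↦ 1 + x` to the group of unipotent upper triangular matrices. -/
noncomputable def toUL : OnePlus F (strictlyUpperTriangular n F) →* UL n F :=
  toMatrix.toHomUnits.codRestrict (UL n F) fun x =>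
    ⟨fun i => by
      change (1 + (x.val : Matrix (Fin n) (Fin n) F)) i i = 1
      rw [Matrix.add_apply, x.val.2 i i le_rfl, Matrix.one_apply_eq, add_zero],
    fun i j hij => by
      change (1 + (x.val : Matrix (Fin n) (Fin n) F)) i j = 0
      rw [Matrix.add_apply, x.val.2 i j hij.le, Matrix.one_apply_ne hij.ne', add_zero]⟩

theorem toUL_surjective : Function.Surjective (toUL (n := n) (F := F)) := by
  rintro ⟨g, hg, hg'⟩
  refine ⟨⟨⟨g.val - 1, fun i j hij => ?_⟩⟩, Subtype.ext (Units.ext ?_)⟩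
  · rcases hij.eq_or_lt with rfl | hij
    · rw [Matrix.sub_apply, hg, Matrix.one_apply_eq, sub_self]
    · rw [Matrix.sub_apply, hg' i j hij, Matrix.one_apply_ne hij.ne', sub_self]
  · change 1 + (g.val - 1) = g.val
    abel

end strictlyUpperTriangular

theorem corollary1p2 {F : Type*} [Field F] [Finite F] (q : ℕ) (hq : Nat.card F = q) :
    (∀ (A : Type*) [NonUnitalRing A] [Module F A] [IsScalarTower F A A] [SMulCommClass F A A]
        [FiniteDimensional F A] [IsNilpotentAlgebra F A]
        (V : Type*) [AddCommGroup V] [Module ℂ V]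
        (π : Representation ℂ (OnePlus F A) V), π.IsIrreducible →
          FiniteDimensional ℂ V ∧ ∃ k : ℕ, Module.finrank ℂ V = q ^ k) ∧
    (∀ (n : ℕ) (V : Type*) [AddCommGroup V] [Module ℂ V]
        (π : Representation ℂ (UL n F) V), π.IsIrreducible →
          FiniteDimensional ℂ V ∧ ∃ k : ℕ, Module.finrank ℂ V = q ^ k) := by
  subst hq
  refine ⟨fun A _ _ _ _ _ _ V _ _ π hπ => OnePlus.exists_finrank_eq_pow A V π hπ,
    fun n V _ _ π hπ => ?_⟩
  have : FiniteDimensional F (strictlyUpperTriangular n F) :=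
    inferInstanceAs (FiniteDimensional F (strictlyUpperTriangular n F).toSubmodule)
  exact OnePlus.exists_finrank_eq_pow (F := F) (strictlyUpperTriangular n F) V _
    (hπ.comp_surjective strictlyUpperTriangular.toUL strictlyUpperTriangular.toUL_surjective)
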